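/- **Setting.** Let $L_1,L_2,T,K_1,K_2>0$, $\beta,\gamma\in(1,2)$, let $J,M_1,M_2,N\ge 1$ be integers, and put $h_1=L_1/M_1$, $h_2=L_2/M_2$, $\tau=T/N$. Let $f:\mathbb R^3\to\mathbb R$ and $\phi:\mathbb R^2\to\mathbb R$ be arbitrary. Let $\omega\ge 0$ be a weight function on $[0,1]$; put $\alpha_r=\frac{r}{2J}$ and $\lambda_r=d_r\,\omega(\alpha_r)\frac1{2J}$ for $0\le r\le m:=2J$, where $d_0=d_{2J}=\frac12$ and $d_r=1$ otherwise, and assume that $\omega(\alpha_r)>0$ for at least one $r<2J$. Let $\sigma$ be the positive root of $$F(\sigma)=\sum_{r=0}^{m}\frac{\lambda_r}{\Gamma(3-\alpha_r)}\,\sigma^{1-\alpha_r}\Big[\sigma-\Big(1-\frac{\alpha_r}2\Big)\Big]\tau^{2-\alpha_r}=0 .$$ For $\alpha\in[0,1]$ put $a_0^{(\alpha)}=\sigma^{1-\alpha}$ and, for $l\ge1$, $$a_l^{(\alpha)}=(l+\sigma)^{1-\alpha}-(l-1+\sigma)^{1-\alpha},$$ $$b_l^{(\alpha)}=\tfrac1{2-\alpha}\big[(l+\sigma)^{2-\alpha}-(l-1+\sigma)^{2-\alpha}\big]-\tfrac12\big[(l+\sigma)^{1-\alpha}+(l-1+\sigma)^{1-\alpha}\big].$$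 Let $c_0^{(1,\alpha)}=a_0^{(\alpha)}$ and, for $n\ge2$, $c_0^{(n,\alpha)}=a_0^{(\alpha)}+b_1^{(\alpha)}$, $c_k^{(n,\alpha)}=a_k^{(\alpha)}+b_{k+1}^{(\alpha)}-b_k^{(\alpha)}$ for $1\le k\le n-2$, $c_{n-1}^{(n,\alpha)}=a_{n-1}^{(\alpha)}-b_{n-1}^{(\alpha)}$. Let $$\hat c_k^{(n)}=\sum_{r=0}^m\lambda_r\frac{\tau^{-\alpha_r}}{\Gamma(2-\alpha_r)}c_k^{(n,\alpha_r)},\qquad g_k^{(\beta)}=\frac{(-1)^k\,\Gamma(\beta+1)}{\Gamma(\beta/2-k+1)\,\Gamma(\beta/2+k+1)}\quad(k\in\mathbb Z),$$ $$c_*^{(\beta)}=\frac2\beta\,e^{-2}\,\frac{(4-\beta)(2-\beta)\beta}{(6+\beta)(4+\beta)(2+\beta)}\cdot\frac{\Gamma(\beta+1)}{\Gamma(\beta/2+1)^2}\Big(3+\frac\beta2\Big)^{\beta+1},$$ and likewise for $\gamma$. **Scheme.** Let $f_{ij}^{n-1+\sigma}=f\big(ih_1,jh_2,(n-1+\sigma)\tau\big)$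 and let $u_{ij}^n$ ($0\le i\le M_1$, $0\le j\le M_2$, $0\le n\le N$) satisfy, for $1\le i\le M_1-1$, $1\le j\le M_2-1$, $1\le n\le N$, $$\sum_{k=0}^{n-1}\hat c_k^{(n)}\big(u_{ij}^{n-k}-u_{ij}^{n-k-1}\big)=-K_1h_1^{-\beta}\sum_{k=i-M_1}^{i}g_k^{(\beta)}\big[\sigma u_{i-k,j}^n+(1-\sigma)u_{i-k,j}^{n-1}\big]-K_2h_2^{-\gamma}\sum_{k=j-M_2}^{j}g_k^{(\gamma)}\big[\sigma u_{i,j-k}^n+(1-\sigma)u_{i,j-k}^{n-1}\big]+f_{ij}^{n-1+\sigma},$$ with $u_{ij}^n=0$ for $0\le n\le N$ whenever $i\in\{0,M_1\}$ or $j\in\{0,M_2\}$, and $u_{ij}^0=\phi(ih_1,jh_2)$ for $1\le i\le M_1-1$, $1\le j\le M_2-1$. Write $\|v\|^2=h_1h_2\sum_{i=1}^{M_1-1}\sum_{j=1}^{M_2-1}v_{ij}^2$. **Theorem (unconditional stability).** For every $1\le n\le N$, $$\|u^n\|^2\le\|u^0\|^2+\frac14\left[\frac{(2L_1)^\beta}{K_1c_*^{(\beta)}}+\frac{(2L_2)^\gamma}{K_2c_*^{(\gamma)}}\right]\frac{1}{\displaystyle\sum_{r=0}^m\frac{\lambda_r}{T^{\alpha_r}\Gamma(1-\alpha_r)}}\;\max_{1\le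 l\le n}\|f^{l-1+\sigma}\|^2,$$ where the term $r=m$ (with $\alpha_m=1$) of the sum in the denominator is $0$, by the convention $1/\Gamma(0)=0$. -/

import Mathlib

noncomputable section

namespace TDRFDE

/-! Composite trapezoid rule in the order variable, with `2 * J` subintervals of `[0, 1]`. -/

/-- The node `α_r = r / (2J)`. -/
def node (J r : ℕ) : ℝ := (r : ℝ) / (2 * (J : ℝ))

/-- The trapezoid weight `d_r`: `1/2` at the two end nodes, `1` otherwise. -/
def trapWeight (J r : ℕ) : ℝ := if r = 0 ∨ r = 2 * J then 1 / 2 else 1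

/-- `λ_r = d_r ω(α_r) Δα` with `Δα = 1 / (2J)`. -/
def lam (J : ℕ) (w : ℝ → ℝ) (r : ℕ) : ℝ :=
  trapWeight J r * w (node J r) * (1 / (2 * (J : ℝ)))

/-- `F(σ) = ∑_r λ_r / Γ(3 - α_r) σ^{1 - α_r} [σ - (1 - α_r / 2)] τ^{2 - α_r}`. -/
def F (J : ℕ) (w : ℝ → ℝ) (τ σ : ℝ) : ℝ :=
  ∑ r ∈ Finset.range (2 * J + 1),
    lam J w r / Real.Gamma (3 - node J r) * σ ^ (1 - node J r)
      * (σ - (1 - node J r / 2)) * τ ^ (2 - node J r)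

/-! Coefficients of the time discretization. -/

/-- `a_0 = σ^{1-α}` and `a_l = (l+σ)^{1-α} - (l-1+σ)^{1-α}` for `l ≥ 1`. -/
def aCoeff (σ α : ℝ) (l : ℕ) : ℝ :=
  if l = 0 then σ ^ (1 - α)
  else ((l : ℝ) + σ) ^ (1 - α) - ((l : ℝ) - 1 + σ) ^ (1 - α)

/-- The coefficient `b_l`, used for `l ≥ 1` only. -/
def bCoeff (σ α : ℝ) (l : ℕ) : ℝ :=
  1 / (2 - α) * (((l : ℝ) + σ) ^ (2 - α) - ((l : ℝ) - 1 + σ) ^ (2 - α))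
    - 1 / 2 * (((l : ℝ) + σ) ^ (1 - α) + ((l : ℝ) - 1 + σ) ^ (1 - α))

/-- The coefficient `c_k^{(n,α)}`, used for `0 ≤ k ≤ n - 1`. -/
def cCoeff (σ α : ℝ) (n k : ℕ) : ℝ :=
  if n = 1 then aCoeff σ α 0
  else if k = 0 then aCoeff σ α 0 + bCoeff σ α 1
  else if k + 2 ≤ n then aCoeff σ α k + bCoeff σ α (k + 1) - bCoeff σ α k
  else aCoeff σ α k - bCoeff σ α k

/-- `ĉ_k^{(n)} = ∑_r λ_r τ^{-α_r} / Γ(2 - α_r) c_k^{(n,α_r)}`. -/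
def cHat (J : ℕ) (w : ℝ → ℝ) (τ σ : ℝ) (n k : ℕ) : ℝ :=
  ∑ r ∈ Finset.range (2 * J + 1),
    lam J w r * (τ ^ (-node J r) / Real.Gamma (2 - node J r)) * cCoeff σ (node J r) n k

/-! Fractional centred differences. -/

/-- `g_k^{(β)} = (-1)^k Γ(β+1) / (Γ(β/2-k+1) Γ(β/2+k+1))`. At a pole of `Γ` in the denominator
(possible only for `β = 2`) Mathlib's `Γ` is `0`, so that the value is the usual `0`. -/
def gCoeff (β : ℝ) (k : ℤ) : ℝ :=
  (-1 : ℝ) ^ k * Real.Gamma (β + 1)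
    / (Real.Gamma (β / 2 - (k : ℝ) + 1) * Real.Gamma (β / 2 + (k : ℝ) + 1))

/-- `∑_{k = i - M}^{i} g_k^{(β)} v_{i-k}`. -/
def centredDiff (β : ℝ) (M : ℕ) (v : ℤ → ℝ) (i : ℤ) : ℝ :=
  ∑ k ∈ Finset.Icc (i - (M : ℤ)) i, gCoeff β k * v (i - k)

/-- `r_β`. -/
def rConst (β : ℝ) : ℝ :=
  Real.exp (-2) * ((4 - β) * (2 - β) * β / ((6 + β) * (4 + β) * (2 + β)))
    * (Real.Gamma (β + 1) / Real.Gamma (β / 2 + 1) ^ 2) * (3 + β / 2) ^ (β + 1)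

/-- `c_*^{(β)} = (2 / β) r_β`. -/
def cStar (β : ℝ) : ℝ := 2 / β * rConst β

/-! The two-dimensional difference scheme. -/

/-- The source term on the grid, `f_{ij}^{n-1+σ} = f (x_i, y_j, (n - 1 + σ) τ)`. -/
def sourceGrid (f : ℝ → ℝ → ℝ → ℝ) (h₁ h₂ τ σ : ℝ) (n : ℕ) (i j : ℤ) : ℝ :=
  f ((i : ℝ) * h₁) ((j : ℝ) * h₂) (((n : ℝ) - 1 + σ) * τ)

/-- `u n i j` (for `0 ≤ n ≤ N`, `0 ≤ i ≤ M₁`, `0 ≤ j ≤ M₂`; other values are irrelevant) solves the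
two-dimensional difference scheme with step sizes `h₁ = L₁ / M₁`, `h₂ = L₂ / M₂`, `τ = T / N`. -/
structure IsSchemeSolution (L₁ L₂ T K₁ K₂ β γ : ℝ) (w : ℝ → ℝ) (f : ℝ → ℝ → ℝ → ℝ)
    (φ : ℝ → ℝ → ℝ) (J M₁ M₂ N : ℕ) (σ : ℝ) (u : ℕ → ℤ → ℤ → ℝ) : Prop where
  eqn : ∀ n : ℕ, 1 ≤ n → n ≤ N → ∀ i j : ℤ, 1 ≤ i → i ≤ (M₁ : ℤ) - 1 → 1 ≤ j → j ≤ (M₂ : ℤ) - 1 →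
    ∑ k ∈ Finset.range n, cHat J w (T / N) σ n k * (u (n - k) i j - u (n - k - 1) i j) =
      - K₁ * (L₁ / M₁) ^ (-β)
          * centredDiff β M₁ (fun p => σ * u n p j + (1 - σ) * u (n - 1) p j) i
      - K₂ * (L₂ / M₂) ^ (-γ)
          * centredDiff γ M₂ (fun q => σ * u n i q + (1 - σ) * u (n - 1) i q) j
      + sourceGrid f (L₁ / M₁) (L₂ / M₂) (T / N) σ n i j
  boundary : ∀ n : ℕ, n ≤ N → ∀ i j : ℤ, 0 ≤ i → i ≤ (M₁ : ℤ) → 0 ≤ j → j ≤ (M₂ : ℤ) →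
    (i = 0 ∨ i = (M₁ : ℤ) ∨ j = 0 ∨ j = (M₂ : ℤ)) → u n i j = 0
  initial : ∀ i j : ℤ, 1 ≤ i → i ≤ (M₁ : ℤ) - 1 → 1 ≤ j → j ≤ (M₂ : ℤ) - 1 →
    u 0 i j = φ ((i : ℝ) * (L₁ / M₁)) ((j : ℝ) * (L₂ / M₂))

/-- The squared discrete `L₂` norm `‖v‖² = h₁ h₂ ∑_{i=1}^{M₁-1} ∑_{j=1}^{M₂-1} v_{ij}²`. -/
def normSq (h₁ h₂ : ℝ) (M₁ M₂ : ℕ) (v : ℤ → ℤ → ℝ) : ℝ :=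
  h₁ * h₂ * ∑ i ∈ Finset.Icc (1 : ℤ) ((M₁ : ℤ) - 1),
    ∑ j ∈ Finset.Icc (1 : ℤ) ((M₂ : ℤ) - 1), v i j ^ 2

/-- `∑_r λ_r / (T^{α_r} Γ(1 - α_r))`. The node `α_{2J} = 1` contributes `0` by the convention
`1 / Γ(0) = 0`, which agrees with Mathlib's `Γ(0) = 0`, `x / 0 = 0`. -/
def weightSum (J : ℕ) (w : ℝ → ℝ) (T : ℝ) : ℝ :=
  ∑ r ∈ Finset.range (2 * J + 1),
    lam J w r / (T ^ (node J r) * Real.Gamma (1 - node J r))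

end TDRFDE

end

noncomputable section
namespace TDRFDE

/-! ### The fractional centred difference -/

/-! The proof is an energy argument: the scheme at level n is tested with v = σ u^n + (1-σ) u^{n-1}
and summed over the interior grid.

In space, the matrix g_{i-j} is symmetric with nonpositive off-diagonal entries, so a lower bound
for its row sums bounds its quadratic form (`le_sum_sum_of_rowSum_le`). The row sums telescope to
two tails of g, which decay no faster than M^{-β}. The factor h^{-β} cancels this decay, so the
coercivity constant A = K₁ c_*^{(β)}/(2L₁)^β + K₂ c_*^{(γ)}/(2L₂)^γ does not depend on the mesh
(`coercive_interior`).

In time, the tested difference dominates ½ Σ ĉ_k (‖u^{n-k}‖² - ‖u^{n-k-1}‖²) as soon as ĉ_k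
decreases from k = 1 on, the last coefficient is nonnegative and σ² ĉ_1 ≤ (2σ-1) ĉ_0
(`sum_mul_sub_sq_le`). The last condition is where F(σ) = 0 enters: order by order, (2σ-1) c_0 - σ²
c_1 is bounded below by a term whose weighted sum is a multiple of F(σ) (`two_mul_sub_mul_cCoeff`,
`sq_mul_cHat_one_le`).

Young's inequality absorbs the source into the coercive term and leaves ‖f‖²/(2A). Since ĉ_{n-1} is
at least half the weight sum (`half_weightSum_le_cHat_last`), this is at most ĉ_{n-1} D, with D the
increment in the claim; strong induction on the level concludes (`le_of_sum_mul_sub_le`). -/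

theorem gCoeff_neg (β : ℝ) (k : ℤ) : gCoeff β (-k) = gCoeff β k := by
  unfold gCoeff
  rw [mul_comm (Real.Gamma _) (Real.Gamma _)]
  push_cast
  rw [sub_neg_eq_add, ← sub_eq_add_neg, zpow_neg, ← inv_zpow]
  norm_num

theorem gCoeff_succ_mul {β : ℝ} (hβ : 1 < β) (hβ' : β < 2) (k : ℤ) :
    gCoeff β (k + 1) * (k + 1 + β / 2) = gCoeff β k * (k - β / 2) := by
  -- As 1/2 < β/2 < 1, no Gamma argument below is an integer, hence none is a pole.
  have key : ∀ m : ℤ, β / 2 + m ≠ 0 := by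
    intro m hm
    have h1 : (-1 : ℝ) < m := by linarith
    have h2 : (m : ℝ) < 0 := by linarith
    have h1' : (-1 : ℤ) < m := by exact_mod_cast h1
    have h2' : m < 0 := by exact_mod_cast h2
    omega
  have e1 : β / 2 - k ≠ 0 := by simpa [sub_eq_add_neg] using key (-k)
  have e2 : β / 2 + k + 1 ≠ 0 := by simpa [add_assoc] using key (k + 1)
  have g1 : Real.Gamma (β / 2 - k + 1) = (β / 2 - k) * Real.Gamma (β / 2 - k) :=
    Real.Gamma_add_one e1
  have g2 : Real.Gamma (β / 2 + k + 1 + 1) = (β / 2 + k + 1) * Real.Gamma (β / 2 + k + 1) :=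
    Real.Gamma_add_one e2
  have n1 : Real.Gamma (β / 2 - k) ≠ 0 := by
    refine Real.Gamma_ne_zero fun m hm => key (-k + m) ?_
    push_cast; linarith
  have n2 : Real.Gamma (β / 2 + k + 1) ≠ 0 := by
    refine Real.Gamma_ne_zero fun m hm => key (k + 1 + m) ?_
    push_cast; linarith
  unfold gCoeff
  push_cast
  rw [show β / 2 - ((k : ℝ) + 1) + 1 = β / 2 - k by ring,
    show β / 2 + ((k : ℝ) + 1) + 1 = β / 2 + k + 1 + 1 by ring, g1, g2,
    zpow_add_one₀ (by norm_num)]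
  generalize Real.Gamma (β / 2 - k) = A at *
  generalize Real.Gamma (β / 2 + k + 1) = B at *
  rw [div_mul_eq_mul_div, div_mul_eq_mul_div, div_eq_div_iff (by positivity) (by positivity)]
  ring

theorem gCoeff_zero_pos {β : ℝ} (hβ : 1 < β) : 0 < gCoeff β 0 := by
  unfold gCoeff
  have h1 := Real.Gamma_pos_of_pos (show 0 < β + 1 by linarith)
  have h2 := Real.Gamma_pos_of_pos (show 0 < β / 2 + 1 by linarith)
  simp only [zpow_zero, Int.cast_zero, sub_zero, add_zero]
  positivity

theorem gCoeff_succ_neg {β : ℝ} (hβ : 1 < β) (hβ' : β < 2) (k : ℕ) :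
    gCoeff β (k + 1) < 0 := by
  induction k with
  | zero =>
    have h := gCoeff_succ_mul hβ hβ' 0
    have h0 := gCoeff_zero_pos hβ
    push_cast at h ⊢
    by_contra! hc
    nlinarith [mul_nonneg hc (show (0 : ℝ) ≤ 0 + 1 + β / 2 by linarith),
      mul_pos h0 (show 0 < β / 2 by linarith)]
  | succ k ih =>
    have h := gCoeff_succ_mul hβ hβ' (k + 1)
    have hk : (0 : ℝ) ≤ k := k.cast_nonneg
    push_cast at h ih ⊢
    by_contra! hc
    nlinarith [mul_nonneg hc (show (0 : ℝ) ≤ (k : ℝ) + 1 + 1 + β / 2 by linarith),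
      mul_pos (neg_pos.2 ih) (show 0 < (k : ℝ) + 1 - β / 2 by linarith)]

theorem gCoeff_nonpos {β : ℝ} (hβ : 1 < β) (hβ' : β < 2) {k : ℤ} (hk : k ≠ 0) :
    gCoeff β k ≤ 0 := by
  rcases lt_or_gt_of_ne hk with h | h
  · obtain ⟨m, hm⟩ := Int.eq_ofNat_of_zero_le (show 0 ≤ -k - 1 by omega)
    rw [← gCoeff_neg, show -k = (m : ℤ) + 1 by omega]
    exact (gCoeff_succ_neg hβ hβ' m).le
  · obtain ⟨m, hm⟩ := Int.eq_ofNat_of_zero_le (show 0 ≤ k - 1 by omega)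
    rw [show k = (m : ℤ) + 1 by omega]
    exact (gCoeff_succ_neg hβ hβ' m).le

/-- The closed form of the tail `-∑_{k ≥ m} g_k`. -/
def gTail (β : ℝ) (m : ℤ) : ℝ := -gCoeff β m * (m + β / 2) / β

theorem gTail_succ {β : ℝ} (hβ : 1 < β) (hβ' : β < 2) (m : ℤ) :
    gTail β (m + 1) = gTail β m + gCoeff β m := by
  have h := gCoeff_succ_mul hβ hβ' m
  have : β ≠ 0 := by linarith
  unfold gTail
  push_cast
  field_simp
  linear_combination -2 * h

/-- This encodes Σ_{k ∈ ℤ} g_k = 0 together with the symmetry of g, without infinite sums. -/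
theorem gTail_one_sub {β : ℝ} (hβ : 1 < β) (hβ' : β < 2) (m : ℤ) :
    gTail β (1 - m) = -gTail β m := by
  have h := gCoeff_succ_mul hβ hβ' (-m)
  rw [gCoeff_neg] at h
  unfold gTail
  rw [show 1 - m = -m + 1 by ring]
  push_cast at h ⊢
  have : β ≠ 0 := by linarith
  field_simp
  linear_combination -2 * h

theorem gTail_succ_mul {β : ℝ} (hβ : 1 < β) (hβ' : β < 2) (m : ℤ) :
    gTail β (m + 1) * (m + β / 2) = gTail β m * (m - β / 2) := by
  have h := gCoeff_succ_mul hβ hβ' m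
  have : β ≠ 0 := by linarith
  unfold gTail
  push_cast
  field_simp
  linear_combination (-2 * (β + 2 * m)) * h

theorem gTail_pos {β : ℝ} (hβ : 1 < β) (hβ' : β < 2) {m : ℤ} (hm : 1 ≤ m) : 0 < gTail β m := by
  obtain ⟨k, hk⟩ := Int.eq_ofNat_of_zero_le (show 0 ≤ m - 1 by omega)
  obtain rfl : m = (k : ℤ) + 1 := by omega
  have h := gCoeff_succ_neg hβ hβ' k
  have : (0 : ℝ) ≤ k := k.cast_nonneg
  unfold gTail
  push_cast
  exact div_pos (mul_pos (neg_pos.2 h) (by linarith)) (by linarith)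

theorem gTail_le_gTail {β : ℝ} (hβ : 1 < β) (hβ' : β < 2) {m m' : ℤ} (hm : 1 ≤ m)
    (hmm : m ≤ m') : gTail β m' ≤ gTail β m := by
  induction m', hmm using Int.leInduction with
  | base => exact le_rfl
  | succ k hk ih =>
    rw [gTail_succ hβ hβ']
    linarith [gCoeff_nonpos hβ hβ' (show k ≠ 0 by omega)]

/-- Polynomial decay of the tails is not faster than `m ^ (-β)`. -/
theorem le_gTail_add_three {β : ℝ} (hβ : 1 < β) (hβ' : β < 2) (m : ℕ) :
    gTail β 3 * (2 / ((m : ℝ) + 2)) ^ β ≤ gTail β ((m : ℤ) + 3) := by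
  induction m with
  | zero => norm_num
  | succ m ih =>
    have h := gTail_succ_mul hβ hβ' ((m : ℤ) + 3)
    have hm : (0 : ℝ) ≤ m := m.cast_nonneg
    have hx : 0 < (m : ℝ) + 3 - β / 2 := by linarith
    have hy : 0 < (m : ℝ) + 3 + β / 2 := by linarith
    push_cast at h ⊢
    rw [show (m : ℤ) + 1 + 3 = m + 3 + 1 by ring, ← mul_le_mul_iff_left₀ hy, h]
    -- With x = m + 3 - β/2 the left side is 1 + β/x. Bernoulli bounds it by (1 + 1/x)^β, and x ≥ m
    -- + 2 because β ≤ 2.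
    have hber : ((m : ℝ) + 3 + β / 2) / ((m : ℝ) + 3 - β / 2)
        ≤ (((m : ℝ) + 3) / ((m : ℝ) + 2)) ^ β := by
      have h1 := one_add_mul_self_le_rpow_one_add
        (show -1 ≤ 1 / ((m : ℝ) + 3 - β / 2) by
          have : 0 ≤ 1 / ((m : ℝ) + 3 - β / 2) := by positivity
          linarith) hβ.le
      calc _ = 1 + β * (1 / ((m : ℝ) + 3 - β / 2)) := by
            rw [mul_one_div, div_eq_iff hx.ne', add_mul, div_mul_cancel₀ _ hx.ne']; ring
        _ ≤ _ := h1
        _ ≤ _ := by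
          refine Real.rpow_le_rpow (by positivity) ?_ (by linarith)
          rw [show ((m : ℝ) + 3) / ((m : ℝ) + 2) = 1 + 1 / ((m : ℝ) + 2) by field_simp; ring]
          have := one_div_le_one_div_of_le (show 0 < (m : ℝ) + 2 by linarith)
            (show (m : ℝ) + 2 ≤ (m : ℝ) + 3 - β / 2 by linarith)
          linarith
    rw [div_le_iff₀ hx] at hber
    have hsplit : (2 / ((m : ℝ) + 2)) ^ β
        = (2 / ((m : ℝ) + 1 + 2)) ^ β * (((m : ℝ) + 3) / ((m : ℝ) + 2)) ^ β := by
      rw [← Real.mul_rpow (by positivity) (by positivity)]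
      congr 1
      field_simp
      ring
    have ht : 0 < gTail β 3 := gTail_pos hβ hβ' (by norm_num)
    calc gTail β 3 * (2 / ((m : ℝ) + 1 + 2)) ^ β * ((m : ℝ) + 3 + β / 2)
        ≤ gTail β 3 * (2 / ((m : ℝ) + 1 + 2)) ^ β *
          ((((m : ℝ) + 3) / ((m : ℝ) + 2)) ^ β * ((m : ℝ) + 3 - β / 2)) := by gcongr
      _ = gTail β 3 * (2 / ((m : ℝ) + 2)) ^ β * ((m : ℝ) + 3 - β / 2) := by rw [hsplit]; ring
      _ ≤ _ := by gcongr

/-- The rational factor in `rConst` is -g_3/g_0, from three steps of the recurrence; one factor 3 +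
β/2 and the 1/β complete the tail at 3. -/
theorem cStar_eq {β : ℝ} (hβ : 1 < β) (hβ' : β < 2) :
    cStar β = 2 * Real.exp (-2) * gTail β 3 * (3 + β / 2) ^ β := by
  have h0 : gCoeff β 0 = Real.Gamma (β + 1) / Real.Gamma (β / 2 + 1) ^ 2 := by
    simp [gCoeff, sq]
  have h1 := gCoeff_succ_mul hβ hβ' 0
  have h2 := gCoeff_succ_mul hβ hβ' 1
  have h3 := gCoeff_succ_mul hβ hβ' 2
  norm_num at h1 h2 h3
  have e1 : gCoeff β 1 = -(gCoeff β 0 * β / (2 + β)) := by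
    field_simp; linarith
  have e2 : gCoeff β 2 = gCoeff β 1 * (2 - β) / (4 + β) := by
    field_simp; linarith
  have e3 : gCoeff β 3 = gCoeff β 2 * (4 - β) / (6 + β) := by
    field_simp; linarith
  unfold cStar rConst gTail
  rw [← h0, e3, e2, e1, Real.rpow_add_one (by positivity)]
  push_cast
  field_simp

theorem cStar_pos {β : ℝ} (hβ : 1 < β) (hβ' : β < 2) : 0 < cStar β := by
  rw [cStar_eq hβ hβ']
  have := gTail_pos hβ hβ' (show (1 : ℤ) ≤ 3 by norm_num)
  positivity

theorem cStar_mul_rpow_le_two_mul_gTail {β : ℝ} (hβ : 1 < β) (hβ' : β < 2) {M : ℕ} {m : ℤ}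
    (hm : 1 ≤ m) (hmM : m < M) : cStar β * (2 * (M : ℝ)) ^ (-β) ≤ 2 * gTail β m := by
  have ht : 0 < gTail β 3 := gTail_pos hβ hβ' (by norm_num)
  have hM : (2 : ℝ) ≤ M := by
    have : 2 ≤ M := by omega
    exact_mod_cast this
  have key : gTail β 3 * (2 / (M : ℝ)) ^ β ≤ gTail β m := by
    by_cases h3 : M ≤ 4
    · have h1 : gTail β 3 ≤ gTail β m := gTail_le_gTail hβ hβ' hm (by omega)
      have h2 : (2 / (M : ℝ)) ^ β ≤ 1 :=
        Real.rpow_le_one (by positivity) ((div_le_one (by linarith)).2 hM) (by linarith)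
      nlinarith
    · obtain ⟨k, rfl⟩ := Nat.exists_eq_add_of_le (show 4 ≤ M by omega)
      have h1 := le_gTail_add_three hβ hβ' k
      have h2 : gTail β ((k : ℤ) + 3) ≤ gTail β m := gTail_le_gTail hβ hβ' hm (by push_cast at hmM; omega)
      refine le_trans ?_ (h1.trans h2)
      gcongr
      push_cast
      linarith
  have hexp : Real.exp (-2) ≤ 1 := Real.exp_le_one_iff.2 (by norm_num)
  -- Here 3 + β/2 ≤ 4, so the base is at most 4/(2M). The factor e^{-2} in `cStar` is pure slack.
  have hpow : (3 + β / 2) ^ β * (2 * (M : ℝ)) ^ (-β) ≤ (2 / (M : ℝ)) ^ β := by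
    rw [Real.rpow_neg (by positivity), ← div_eq_mul_inv, ← Real.div_rpow (by positivity) (by positivity)]
    refine Real.rpow_le_rpow (by positivity) ?_ (by linarith)
    rw [div_le_div_iff₀ (by positivity) (by positivity)]
    nlinarith
  rw [cStar_eq hβ hβ']
  calc _ = Real.exp (-2) * (2 * (gTail β 3 * ((3 + β / 2) ^ β * (2 * (M : ℝ)) ^ (-β)))) := by ring
    _ ≤ 1 * (2 * (gTail β 3 * (2 / (M : ℝ)) ^ β)) := by gcongr
    _ ≤ _ := by linarith

theorem sum_Icc_gCoeff {β : ℝ} (hβ : 1 < β) (hβ' : β < 2) (i : ℤ) {m : ℤ} (hm : 0 ≤ m) :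
    ∑ j ∈ Finset.Icc 1 m, gCoeff β (i - j) = gTail β i - gTail β (i - m) := by
  induction m, hm using Int.leInduction with
  | base => simp
  | succ m hm ih =>
    have : Finset.Icc 1 (m + 1) = insert (m + 1) (Finset.Icc 1 m) := by
      ext x; simp only [Finset.mem_Icc, Finset.mem_insert]; omega
    rw [this, Finset.sum_insert (by simp), ih]
    have h := gTail_succ hβ hβ' (i - (m + 1))
    rw [show i - (m + 1) + 1 = i - m by ring] at h
    linarith

theorem centredDiff_eq_sum {β : ℝ} {M : ℕ} {v : ℤ → ℝ} (h0 : v 0 = 0)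
    (h1 : v M = 0) (i : ℤ) :
    centredDiff β M v i = ∑ j ∈ Finset.Icc (1 : ℤ) ((M : ℤ) - 1), gCoeff β (i - j) * v j := by
  have e : centredDiff β M v i = ∑ j ∈ Finset.Icc (0 : ℤ) M, gCoeff β (i - j) * v j := by
    unfold centredDiff
    refine Finset.sum_bij' (fun k _ => i - k) (fun k _ => i - k) ?_ ?_ ?_ ?_ ?_
    · intro k hk; simp only [Finset.mem_Icc] at hk ⊢; omega
    · intro k hk; simp only [Finset.mem_Icc] at hk ⊢; omega
    · intro k _; ring
    · intro k _; ring
    · intro k _; simp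
  rw [e]
  symm
  refine Finset.sum_subset ?_ ?_
  · intro k hk; simp only [Finset.mem_Icc] at hk ⊢; omega
  · intro k hk hk'
    simp only [Finset.mem_Icc, not_and, not_le] at hk hk'
    have : k = 0 ∨ k = M := by
      by_contra hc
      push Not at hc
      have := hk' (by omega)
      omega
    rcases this with rfl | rfl
    · rw [h0, mul_zero]
    · rw [h1, mul_zero]

/-- Diagonal dominance: for a_ij ≤ 0, a_ij v_i v_j ≥ a_ij (v_i² + v_j²)/2, and by symmetry the right
sides add up to row sums times v_i². -/
theorem le_sum_sum_of_rowSum_le {ι : Type*} (s : Finset ι) (a : ι → ι → ℝ)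
    (hsymm : ∀ i ∈ s, ∀ j ∈ s, a i j = a j i)
    (hneg : ∀ i ∈ s, ∀ j ∈ s, i ≠ j → a i j ≤ 0) (c : ℝ)
    (hrow : ∀ i ∈ s, c ≤ ∑ j ∈ s, a i j) (v : ι → ℝ) :
    c * ∑ i ∈ s, v i ^ 2 ≤ ∑ i ∈ s, (∑ j ∈ s, a i j * v j) * v i := by
  have hpt : ∀ i ∈ s, ∀ j ∈ s, a i j * (v i ^ 2 + v j ^ 2) / 2 ≤ a i j * v j * v i := by
    intro i hi j hj
    by_cases hij : i = j
    · subst hij; apply le_of_eq; ring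
    · nlinarith [mul_nonneg (neg_nonneg.2 (hneg i hi j hj hij)) (sq_nonneg (v i - v j))]
  have hsw : ∑ i ∈ s, ∑ j ∈ s, a i j * v j ^ 2 = ∑ i ∈ s, ∑ j ∈ s, a i j * v i ^ 2 := by
    rw [Finset.sum_comm]
    exact Finset.sum_congr rfl fun i hi => Finset.sum_congr rfl fun j hj => by rw [hsymm i hi j hj]
  calc c * ∑ i ∈ s, v i ^ 2 ≤ ∑ i ∈ s, ∑ j ∈ s, a i j * v i ^ 2 := by
        rw [Finset.mul_sum]
        refine Finset.sum_le_sum fun i hi => ?_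
        rw [← Finset.sum_mul]
        exact mul_le_mul_of_nonneg_right (hrow i hi) (sq_nonneg _)
    _ = ∑ i ∈ s, ∑ j ∈ s, a i j * (v i ^ 2 + v j ^ 2) / 2 := by
        simp_rw [mul_add, add_div, Finset.sum_add_distrib, ← Finset.sum_div]
        rw [hsw]; ring
    _ ≤ ∑ i ∈ s, ∑ j ∈ s, a i j * v j * v i :=
        Finset.sum_le_sum fun i hi => Finset.sum_le_sum fun j hj => hpt i hi j hj
    _ = _ := by simp_rw [Finset.sum_mul]

/-- Coercivity of the fractional centred difference under zero boundary values. -/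
theorem cStar_mul_sum_sq_le {β : ℝ} (hβ : 1 < β) (hβ' : β < 2) {M : ℕ} (hM : 1 ≤ M)
    {v : ℤ → ℝ} (h0 : v 0 = 0) (h1 : v M = 0) :
    cStar β * (2 * (M : ℝ)) ^ (-β) * ∑ i ∈ Finset.Icc (1 : ℤ) ((M : ℤ) - 1), v i ^ 2
      ≤ ∑ i ∈ Finset.Icc (1 : ℤ) ((M : ℤ) - 1), centredDiff β M v i * v i := by
  simp_rw [centredDiff_eq_sum h0 h1]
  refine le_sum_sum_of_rowSum_le _ (fun i j => gCoeff β (i - j)) ?_ ?_ _ ?_ v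
  · intro i _ j _
    rw [← gCoeff_neg, neg_sub]
  · intro i _ j _ hij
    exact gCoeff_nonpos hβ hβ' (sub_ne_zero.2 hij)
  · intro i hi
    rw [Finset.mem_Icc] at hi
    -- Row i sums to the tail at i plus the tail at M - i, each at least half the constant.
    rw [sum_Icc_gCoeff hβ hβ' i (by omega), show i - ((M : ℤ) - 1) = 1 - (M - i) by ring,
      gTail_one_sub hβ hβ']
    have e1 := cStar_mul_rpow_le_two_mul_gTail hβ hβ' (M := M) (m := i) (by omega) (by omega)
    have e2 := cStar_mul_rpow_le_two_mul_gTail hβ hβ' (M := M) (m := M - i) (by omega) (by omega)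
    linarith


/-! ### Differences of powers -/

theorem hasDerivAt_rpow_add {s t : ℝ} (c : ℝ) (ht : 0 < t + c) :
    HasDerivAt (fun x : ℝ => (x + c) ^ s) (s * (t + c) ^ (s - 1)) t := by
  simpa using ((hasDerivAt_id t).add_const c).rpow_const (p := s) (Or.inl ht.ne')

theorem hasDerivAt_rpow_primitive {s t : ℝ} (hs : 0 ≤ s) (c : ℝ) (ht : 0 < t + c) :
    HasDerivAt (fun x : ℝ => (x + c) ^ (1 + s) / (1 + s)) ((t + c) ^ s) t := by
  have h := (hasDerivAt_rpow_add (s := 1 + s) c ht).div_const (1 + s)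
  have hs' : 1 + s ≠ 0 := by positivity
  rwa [mul_div_cancel_left₀ _ hs', add_sub_cancel_left] at h

theorem le_of_hasDerivAt_nonneg {f f' : ℝ → ℝ} (hf : ∀ t, 0 < t → HasDerivAt f (f' t) t)
    (hf' : ∀ t, 0 < t → 0 ≤ f' t) {x y : ℝ} (hx : 0 < x) (hxy : x ≤ y) : f x ≤ f y := by
  refine monotoneOn_of_deriv_nonneg (convex_Ioi 0)
    (fun t ht => (hf t ht).continuousAt.continuousWithinAt) ?_ ?_ hx (hx.trans_le hxy) hxy
  · rw [interior_Ioi]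
    exact fun t ht => (hf t ht).differentiableAt.differentiableWithinAt
  · rw [interior_Ioi]
    intro t ht
    rw [(hf t ht).deriv]
    exact hf' t ht

theorem rpow_second_diff_nonpos {s t : ℝ} (hs : 0 ≤ s) (hs1 : s ≤ 1) (ht : 0 < t) :
    (t + 2) ^ s - 2 * (t + 1) ^ s + t ^ s ≤ 0 := by
  have h := (Real.concaveOn_rpow hs hs1).2 (show t ∈ Set.Ici 0 from ht.le)
    (show t + 2 ∈ Set.Ici (0 : ℝ) from by simp only [Set.mem_Ici]; linarith)
    (show (0 : ℝ) ≤ 1 / 2 by norm_num) (show (0 : ℝ) ≤ 1 / 2 by norm_num) (by norm_num)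
  simp only [smul_eq_mul] at h
  rw [show 1 / 2 * t + 1 / 2 * (t + 2) = t + 1 by ring] at h
  linarith

/-- Since t(t+2) ≤ (t+1)² and s ≤ 0, the middle power is at most the geometric mean of the outer
ones, hence at most their arithmetic mean. -/
theorem rpow_second_diff_nonneg {s t : ℝ} (hs : s ≤ 0) (ht : 0 < t) :
    0 ≤ (t + 2) ^ s - 2 * (t + 1) ^ s + t ^ s := by
  have h : ((t + 1) ^ s) ^ 2 ≤ t ^ s * (t + 2) ^ s := by
    rw [← Real.mul_rpow ht.le (by linarith), sq, ← Real.mul_rpow (by linarith) (by linarith)]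
    exact Real.rpow_le_rpow_of_nonpos (by positivity) (by nlinarith) hs
  have h0 : 0 < t ^ s := Real.rpow_pos_of_pos ht _
  have h2 : 0 < (t + 2) ^ s := Real.rpow_pos_of_pos (by linarith) _
  have := abs_le_of_sq_le_sq' (show (2 * (t + 1) ^ s) ^ 2 ≤ (t ^ s + (t + 2) ^ s) ^ 2 by
    nlinarith [sq_nonneg (t ^ s - (t + 2) ^ s)]) (by positivity)
  linarith [this.2]

theorem rpow_third_diff_nonneg {s t : ℝ} (hs : 0 ≤ s) (hs1 : s ≤ 1) (ht : 0 < t) :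
    0 ≤ (t + 3) ^ s - 3 * (t + 2) ^ s + 3 * (t + 1) ^ s - t ^ s := by
  have h := le_of_hasDerivAt_nonneg
    (f := fun x => (x + 2) ^ s - 2 * (x + 1) ^ s + (x + 0) ^ s)
    (fun x hx => ((hasDerivAt_rpow_add 2 (by linarith)).sub
      ((hasDerivAt_rpow_add 1 (by linarith)).const_mul 2)).add
      (hasDerivAt_rpow_add 0 (by linarith)))
    (fun x hx => by
      have := mul_nonneg hs (rpow_second_diff_nonneg (show s - 1 ≤ 0 by linarith) hx)
      rw [add_zero]
      linarith) ht (show t ≤ t + 1 by linarith)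
  simp only [add_zero] at h
  rw [show t + 1 + 2 = t + 3 by ring, show t + 1 + 1 = t + 2 by ring] at h
  linarith

theorem rpow_primitive_third_diff_nonpos {s t : ℝ} (hs : 0 ≤ s) (hs1 : s ≤ 1) (ht : 0 < t) :
    ((t + 3) ^ (1 + s) - 3 * (t + 2) ^ (1 + s) + 3 * (t + 1) ^ (1 + s) - t ^ (1 + s)) / (1 + s)
      ≤ 0 := by
  have h := le_of_hasDerivAt_nonneg
    (f := fun x => 2 * ((x + 1) ^ (1 + s) / (1 + s)) - (x + 2) ^ (1 + s) / (1 + s)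
      - (x + 0) ^ (1 + s) / (1 + s))
    (fun x hx => (((hasDerivAt_rpow_primitive hs 1 (by linarith)).const_mul 2).sub
      (hasDerivAt_rpow_primitive hs 2 (by linarith))).sub
      (hasDerivAt_rpow_primitive hs 0 (by linarith)))
    (fun x hx => by
      have := rpow_second_diff_nonpos hs hs1 hx
      rw [add_zero]
      linarith) ht (show t ≤ t + 1 by linarith)
  simp only [add_zero] at h
  rw [show t + 1 + 2 = t + 3 by ring, show t + 1 + 1 = t + 2 by ring] at h
  rw [sub_div, add_div, sub_div, mul_div_assoc, mul_div_assoc]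
  linarith

theorem rpow_le_tangent {s t y : ℝ} (hs : 0 ≤ s) (hs1 : s ≤ 1) (ht : 0 < t) (hy : 0 ≤ y) :
    y ^ s ≤ t ^ s + s * t ^ (s - 1) * (y - t) := by
  have h := rpow_one_add_le_one_add_mul_self (s := y / t - 1)
    (by have : 0 ≤ y / t := by positivity
        linarith) hs hs1
  rw [add_sub_cancel, Real.div_rpow hy ht.le, div_le_iff₀ (Real.rpow_pos_of_pos ht _)] at h
  refine h.trans_eq ?_
  rw [Real.rpow_sub_one ht.ne']
  field_simp

theorem tangent_le_rpow {s x y : ℝ} (hs : 0 ≤ s) (hx : 0 < x) (hy : 0 ≤ y) :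
    x ^ (1 + s) + (1 + s) * x ^ s * (y - x) ≤ y ^ (1 + s) := by
  have h := one_add_mul_self_le_rpow_one_add (s := y / x - 1)
    (by have : 0 ≤ y / x := by positivity
        linarith) (show 1 ≤ 1 + s by linarith)
  rw [add_sub_cancel, Real.div_rpow hy hx.le, le_div_iff₀ (Real.rpow_pos_of_pos hx _)] at h
  refine le_of_eq_of_le ?_ h
  rw [Real.rpow_add hx, Real.rpow_one]
  field_simp

/-- The trapezoid rule underestimates the integral of a concave power. In x, the error has as
derivative half the gap between the tangent at x and the function at y. -/
theorem trapezoid_le_rpow_primitive {s x y : ℝ} (hs : 0 ≤ s) (hs1 : s ≤ 1) (hy : 0 < y)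
    (hyx : y ≤ x) :
    (x - y) * (x ^ s + y ^ s) / 2 ≤ (x ^ (1 + s) - y ^ (1 + s)) / (1 + s) := by
  have h := le_of_hasDerivAt_nonneg
    (f := fun t => (t + 0) ^ (1 + s) / (1 + s) - (t - y) * ((t + 0) ^ s + y ^ s) / 2)
    (fun t ht => (hasDerivAt_rpow_primitive hs 0 (by linarith)).sub
      ((((hasDerivAt_id t).sub_const y).mul
        ((hasDerivAt_rpow_add 0 (by linarith)).add_const (y ^ s))).div_const 2))
    (fun t ht => by
      have := rpow_le_tangent hs hs1 ht hy.le
      simp only [id_eq, add_zero]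
      linarith) hy hyx
  simp only [add_zero, sub_self, zero_mul, zero_div, sub_zero] at h
  rw [sub_div]
  linarith

/-! ### The time coefficients for one fractional order -/

/-- b_l is the trapezoid error for x^{1-α} on [l-1+σ, l+σ]. -/
theorem bCoeff_nonneg {σ α : ℝ} (hσ : 0 < σ) (h0 : 0 ≤ α) (h1 : α ≤ 1) {l : ℕ} (hl : 1 ≤ l) :
    0 ≤ bCoeff σ α l := by
  have hl' : (1 : ℝ) ≤ l := by exact_mod_cast hl
  have h := trapezoid_le_rpow_primitive (s := 1 - α) (by linarith) (by linarith)
    (show 0 < (l : ℝ) - 1 + σ by linarith) (show (l : ℝ) - 1 + σ ≤ l + σ by linarith)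
  unfold bCoeff
  rw [show 1 + (1 - α) = 2 - α by ring, show (l : ℝ) + σ - (l - 1 + σ) = 1 by ring] at h
  rw [one_div_mul_eq_div]
  linarith

theorem aCoeff_of_pos {σ α : ℝ} {l : ℕ} (hl : 1 ≤ l) :
    aCoeff σ α l = ((l : ℝ) + σ) ^ (1 - α) - ((l : ℝ) - 1 + σ) ^ (1 - α) := by
  rw [aCoeff, if_neg (by omega)]

/-- With f = x^{1-α} and x = l + σ, the integral in b_l is at most f(x), so a_l - b_l ≥ (f(x) -
f(x-1))/2, and concavity gives f(x) - f(x-1) ≥ f'(x). -/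
theorem le_aCoeff_sub_bCoeff {σ α : ℝ} (hσ : 0 < σ) (h0 : 0 ≤ α) (h1 : α ≤ 1) {l : ℕ}
    (hl : 1 ≤ l) :
    (1 - α) / 2 * ((l : ℝ) + σ) ^ (-α) ≤ aCoeff σ α l - bCoeff σ α l := by
  have hl' : (1 : ℝ) ≤ l := by exact_mod_cast hl
  have ht := rpow_le_tangent (s := 1 - α) (by linarith) (by linarith)
    (show 0 < (l : ℝ) + σ by linarith) (show 0 ≤ (l : ℝ) - 1 + σ by linarith)
  have hG := tangent_le_rpow (s := 1 - α) (by linarith)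
    (show 0 < (l : ℝ) + σ by linarith) (show 0 ≤ (l : ℝ) - 1 + σ by linarith)
  rw [aCoeff_of_pos hl, bCoeff]
  rw [show 1 - α - 1 = -α by ring, show (l : ℝ) - 1 + σ - (l + σ) = -1 by ring] at ht
  rw [show 1 + (1 - α) = 2 - α by ring, show (l : ℝ) - 1 + σ - (l + σ) = -1 by ring] at hG
  have hG' : 1 / (2 - α) * (((l : ℝ) + σ) ^ (2 - α) - ((l : ℝ) - 1 + σ) ^ (2 - α))
      ≤ ((l : ℝ) + σ) ^ (1 - α) := by
    rw [one_div_mul_eq_div, div_le_iff₀ (by linarith)]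
    linarith
  linarith

/-- For f = x^{1-α} with primitive G, the expression equals ½ Δ³f - Δ³G at k - 1 + σ. -/
theorem aCoeff_bCoeff_third_diff_nonneg {σ α : ℝ} (hσ : 0 < σ) (h0 : 0 ≤ α) (h1 : α ≤ 1) {k : ℕ}
    (hk : 1 ≤ k) :
    0 ≤ aCoeff σ α k - aCoeff σ α (k + 1) + 2 * bCoeff σ α (k + 1) - bCoeff σ α k
      - bCoeff σ α (k + 2) := by
  have hk' : (1 : ℝ) ≤ k := by exact_mod_cast hk
  obtain ⟨t, ht⟩ : ∃ t, t = (k : ℝ) - 1 + σ := ⟨_, rfl⟩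
  have ht0 : 0 < t := by linarith
  have hf := rpow_third_diff_nonneg (s := 1 - α) (by linarith) (by linarith) ht0
  have hG := rpow_primitive_third_diff_nonpos (s := 1 - α) (by linarith) (by linarith) ht0
  rw [aCoeff_of_pos hk, aCoeff_of_pos (by omega), bCoeff, bCoeff, bCoeff]
  push_cast
  rw [show (k : ℝ) + 2 + σ = t + 3 by linarith, show (k : ℝ) + 1 + σ = t + 2 by linarith,
    show (k : ℝ) + 2 - 1 + σ = t + 2 by linarith, show (k : ℝ) + 1 - 1 + σ = t + 1 by linarith,
    show (k : ℝ) + σ = t + 1 by linarith, ← ht]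
  rw [show 1 + (1 - α) = 2 - α by ring, ← one_div_mul_eq_div] at hG
  linarith

theorem cCoeff_succ_le {σ α : ℝ} (hσ : 0 < σ) (h0 : 0 ≤ α) (h1 : α ≤ 1) {n k : ℕ}
    (hk : 1 ≤ k) (hkn : k + 1 < n) : cCoeff σ α n (k + 1) ≤ cCoeff σ α n k := by
  have h := aCoeff_bCoeff_third_diff_nonneg hσ h0 h1 hk
  have hb := bCoeff_nonneg hσ h0 h1 (show 1 ≤ k + 2 by omega)
  rw [cCoeff, cCoeff, if_neg (show n ≠ 1 by omega), if_neg (show n ≠ 1 by omega),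
    if_neg (show k + 1 ≠ 0 by omega), if_neg (show k ≠ 0 by omega),
    if_pos (show k + 2 ≤ n by omega)]
  -- If k + 1 = n - 1, the last coefficient lacks its b_{k+2}, which only helps as b_{k+2} ≥ 0.
  split_ifs
  · rw [show k + 1 + 1 = k + 2 by ring]; linarith
  · linarith

theorem le_cCoeff_last {σ α : ℝ} (hσ : 1 / 2 ≤ σ) (h0 : 0 ≤ α) (h1 : α ≤ 1) {n : ℕ}
    (hn : 1 ≤ n) :
    (1 - α) / 2 * ((n : ℝ) - 1 + σ) ^ (-α) ≤ cCoeff σ α n (n - 1) := by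
  have hσ0 : 0 < σ := by linarith
  obtain ⟨k, rfl⟩ := Nat.exists_eq_add_of_le' hn
  rw [Nat.add_sub_cancel]
  push_cast
  rw [add_sub_cancel_right]
  rcases Nat.eq_zero_or_pos k with rfl | hk
  · simp only [cCoeff, aCoeff, zero_add, if_true, Nat.cast_zero]
    rw [sub_eq_add_neg, Real.rpow_add hσ0, Real.rpow_one]
    exact mul_le_mul_of_nonneg_right (by linarith) (Real.rpow_nonneg hσ0.le _)
  · rw [cCoeff, if_neg (by omega), if_neg (by omega), if_neg (by omega)]
    exact le_aCoeff_sub_bCoeff hσ0 h0 h1 hk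

/-- Normalized form, with s = 1 - α and u = 1/(1+σ), of the inequality among powers of σ, 1+σ and
2+σ needed in `two_mul_sub_mul_cCoeff`; σ ≥ 1/2 becomes u ≤ 2/3. -/
theorem three_power_combination_nonneg {s u : ℝ} (hs : 0 ≤ s) (hs1 : s ≤ 1) (hu : 0 < u)
    (hu1 : u ≤ 2 / 3) :
    0 ≤ (2 - 2 * u - u ^ 2) * (2 - (1 + s) * u)
      - (1 - u) ^ 2 * (2 + (1 - s) * u) * (1 + u) ^ s - (2 - (3 + s) * u) * (1 - u) ^ s := by
  have hA : (1 + u) ^ s ≤ 1 + s * u :=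
    rpow_one_add_le_one_add_mul_self (by linarith) hs hs1
  have hA' := mul_le_mul_of_nonneg_left hA
    (show 0 ≤ (1 - u) ^ 2 * (2 + (1 - s) * u) by
      have : 0 ≤ (1 - s) * u := mul_nonneg (by linarith) hu.le
      positivity)
  have hid : (2 - 2 * u - u ^ 2) * (2 - (1 + s) * u)
      - (1 - u) ^ 2 * (2 + (1 - s) * u) * (1 + s * u)
      = (2 - (3 + s) * u) * (1 - s * u) + u ^ 3 * (2 - u) * (s * (1 - s)) := by ring
  have hss : 0 ≤ s * (1 - s) := mul_nonneg hs (by linarith)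
  have hrem : 0 ≤ u ^ 3 * (2 - u) * (s * (1 - s)) :=
    mul_nonneg (mul_nonneg (by positivity) (by linarith)) hss
  rcases le_total 0 (2 - (3 + s) * u) with hC | hC
  · have hB : (1 - u) ^ s ≤ 1 - s * u := by
      have := rpow_one_add_le_one_add_mul_self (s := -u) (by linarith) hs hs1
      rwa [← sub_eq_add_neg, mul_neg, ← sub_eq_add_neg] at this
    nlinarith [mul_le_mul_of_nonneg_left hB hC]
  · have h1u : 0 < 1 - u := by linarith
    have hw : 0 < 1 - u + s * u := by positivity
    -- The coefficient of (1-u)^s now has the other sign, so a lower bound is needed: Bernoulli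
    -- applied to (1-u)^{-1} = 1 + u/(1-u).
    have hB : 1 - u ≤ (1 - u) ^ s * (1 - u + s * u) := by
      have h2 : (1 + u / (1 - u)) ^ s ≤ 1 + s * (u / (1 - u)) :=
        rpow_one_add_le_one_add_mul_self
          (by have : 0 ≤ u / (1 - u) := by positivity
              linarith) hs hs1
      rw [show 1 + u / (1 - u) = 1 / (1 - u) by field_simp; ring,
        Real.div_rpow (by norm_num) h1u.le, Real.one_rpow,
        div_le_iff₀ (Real.rpow_pos_of_pos h1u _)] at h2
      have h3 := mul_le_mul_of_nonneg_right h2 h1u.le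
      have h4 : (1 + s * (u / (1 - u))) * (1 - u) ^ s * (1 - u)
          = (1 - u) ^ s * (1 - u + s * u) := by field_simp
      linarith
    -- Affine in s, so the endpoints s = 1 (`e1`) and s = 0 (`e0`) suffice.
    have hq : 0 ≤ (1 - u + s * u) * (u * (2 - u)) + (2 - (3 + s) * u) := by
      have e1 : 0 ≤ 2 - 2 * u - u ^ 2 := by nlinarith
      have e0 : 0 ≤ 2 - u - 3 * u ^ 2 + u ^ 3 := by nlinarith [mul_pos hu hu]
      nlinarith [mul_nonneg hs e1, mul_nonneg (show 0 ≤ 1 - s by linarith) e0]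
    have hmain : 0 ≤ (1 - u + s * u) * ((2 - (3 + s) * u) * (1 - s * u)
        + u ^ 3 * (2 - u) * (s * (1 - s)) - (2 - (3 + s) * u) * (1 - u) ^ s) := by
      have e := mul_nonneg (mul_nonneg hss (sq_nonneg u)) hq
      have e' := mul_nonneg (neg_nonneg.2 hC) (sub_nonneg.2 hB)
      linarith
    have := nonneg_of_mul_nonneg_right hmain hw
    linarith

/-- The lower bound may be negative for a single α; it is chosen as the summand of F(σ), up to
positive factors, so that it cancels in the weighted sum. -/
theorem two_mul_sub_mul_cCoeff {σ α : ℝ} (hσ : 1 / 2 ≤ σ) (h0 : 0 ≤ α) (h1 : α ≤ 1) {n : ℕ} (hn : 2 ≤ n) :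
    σ ^ (1 - α) * (2 * σ - 2 + α) / (2 - α)
      ≤ (2 * σ - 1) * cCoeff σ α n 0 - σ ^ 2 * cCoeff σ α n 1 := by
  have hσ0 : 0 < σ := by linarith
  have hx : 0 < 1 + σ := by linarith
  have hb2 := bCoeff_nonneg hσ0 h0 h1 (show 1 ≤ 2 by norm_num)
  have hc1 : cCoeff σ α n 1 ≤ aCoeff σ α 1 + bCoeff σ α 2 - bCoeff σ α 1 := by
    unfold cCoeff
    rw [if_neg (by omega), if_neg (by omega)]
    split_ifs <;> linarith
  have hc0 : cCoeff σ α n 0 = aCoeff σ α 0 + bCoeff σ α 1 := by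
    unfold cCoeff
    rw [if_neg (by omega), if_pos rfl]
  have key : 0 ≤ (2 * σ ^ 2 + 2 * σ - 1) * (2 * σ + α) * (1 + σ) ^ (1 - α)
      - σ ^ 2 * (2 + 2 * σ + α) * (2 + σ) ^ (1 - α)
      - (1 + σ) ^ 2 * (2 * σ - 2 + α) * σ ^ (1 - α) := by
    have h := three_power_combination_nonneg (s := 1 - α) (u := 1 / (1 + σ)) (by linarith)
      (by linarith) (by positivity) (by rw [div_le_div_iff₀ hx (by norm_num)]; linarith)
    have e2 : (2 + σ) ^ (1 - α) = (1 + σ) ^ (1 - α) * (1 + 1 / (1 + σ)) ^ (1 - α) := by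
      rw [← Real.mul_rpow hx.le (by positivity)]
      congr 1; field_simp; ring
    have e3 : σ ^ (1 - α) = (1 + σ) ^ (1 - α) * (1 - 1 / (1 + σ)) ^ (1 - α) := by
      have : 1 - 1 / (1 + σ) = σ / (1 + σ) := by field_simp; ring
      rw [this, ← Real.mul_rpow hx.le (by positivity)]
      congr 1; field_simp
    have hp : 0 ≤ (1 + σ) ^ (1 - α) * (1 + σ) ^ 3 := by positivity
    refine (mul_nonneg hp h).trans_eq ?_
    rw [e2, e3]
    generalize (1 + 1 / (1 + σ)) ^ (1 - α) = Y
    generalize (1 - 1 / (1 + σ)) ^ (1 - α) = Z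
    generalize (1 + σ) ^ (1 - α) = X
    field_simp
    ring
  have e : ∀ y : ℝ, 0 < y → y ^ (2 - α) = y * y ^ (1 - α) := fun y hy => by
    rw [show 2 - α = 1 + (1 - α) by ring, Real.rpow_add hy, Real.rpow_one]
  have h2α : 0 < 2 - α := by linarith
  refine le_trans ?_ (sub_le_sub_left (mul_le_mul_of_nonneg_left hc1 (sq_nonneg σ)) _)
  rw [hc0, aCoeff_of_pos le_rfl, bCoeff, bCoeff, aCoeff, if_pos rfl]
  norm_num
  rw [← sub_nonneg, e _ hσ0, e _ hx, e _ (show 0 < 2 + σ by linarith)]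
  refine (div_nonneg key (show 0 ≤ 2 * (2 - α) by linarith)).trans_eq ?_
  field_simp
  ring


/-! ### The coefficients of the distributed order -/

theorem node_nonneg (J r : ℕ) : 0 ≤ node J r := by unfold node; positivity

theorem node_le_one {J r : ℕ} (hJ : 1 ≤ J) (hr : r ≤ 2 * J) : node J r ≤ 1 := by
  have h1 : (1 : ℝ) ≤ J := by exact_mod_cast hJ
  have h2 : (r : ℝ) ≤ 2 * J := by exact_mod_cast hr
  exact (div_le_one (by linarith)).2 h2

theorem node_lt_one {J r : ℕ} (hJ : 1 ≤ J) (hr : r < 2 * J) : node J r < 1 := by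
  have h1 : (1 : ℝ) ≤ J := by exact_mod_cast hJ
  have h2 : (r : ℝ) < 2 * J := by exact_mod_cast hr
  exact (div_lt_one (by linarith)).2 h2

theorem trapWeight_pos (J r : ℕ) : 0 < trapWeight J r := by
  unfold trapWeight; split_ifs <;> norm_num

theorem lam_nonneg {J r : ℕ} (hJ : 1 ≤ J) (hr : r ≤ 2 * J) {w : ℝ → ℝ}
    (hw : ∀ α ∈ Set.Icc (0 : ℝ) 1, 0 ≤ w α) : 0 ≤ lam J w r := by
  have := hw _ ⟨node_nonneg J r, node_le_one hJ hr⟩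
  have := trapWeight_pos J r
  unfold lam
  positivity

theorem lam_pos {J r : ℕ} (hJ : 1 ≤ J) {w : ℝ → ℝ} (hw : 0 < w (node J r)) : 0 < lam J w r := by
  have := trapWeight_pos J r
  have : (0 : ℝ) < J := by exact_mod_cast hJ
  unfold lam
  positivity

/-- The weight `p_r = λ_r τ^{-α_r} / Γ(2 - α_r)` of the order `α_r` in `ĉ_k`. -/
def orderWeight (J : ℕ) (w : ℝ → ℝ) (τ : ℝ) (r : ℕ) : ℝ :=
  lam J w r * (τ ^ (-node J r) / Real.Gamma (2 - node J r))

theorem cHat_eq_sum (J : ℕ) (w : ℝ → ℝ) (τ σ : ℝ) (n k : ℕ) :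
    cHat J w τ σ n k
      = ∑ r ∈ Finset.range (2 * J + 1), orderWeight J w τ r * cCoeff σ (node J r) n k := rfl

section
variable {J : ℕ} {w : ℝ → ℝ} {τ σ : ℝ}

theorem orderWeight_nonneg (hJ : 1 ≤ J) (hw : ∀ α ∈ Set.Icc (0 : ℝ) 1, 0 ≤ w α) (hτ : 0 < τ)
    {r : ℕ} (hr : r ≤ 2 * J) : 0 ≤ orderWeight J w τ r := by
  have h1 := node_le_one hJ hr
  have h2 := Real.Gamma_pos_of_pos (show 0 < 2 - node J r by linarith)
  have h3 := lam_nonneg hJ hr hw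
  unfold orderWeight
  positivity

theorem orderWeight_pos (hJ : 1 ≤ J) (hτ : 0 < τ) {r : ℕ} (hr : r ≤ 2 * J)
    (hw : 0 < w (node J r)) : 0 < orderWeight J w τ r := by
  have h1 := node_le_one hJ hr
  have h2 := Real.Gamma_pos_of_pos (show 0 < 2 - node J r by linarith)
  have h3 := lam_pos hJ hw
  unfold orderWeight
  positivity

theorem F_eq_sum (hJ : 1 ≤ J) (hτ : 0 < τ) :
    F J w τ σ = τ ^ 2 / 2 * ∑ r ∈ Finset.range (2 * J + 1),
      orderWeight J w τ r * (σ ^ (1 - node J r) * (2 * σ - 2 + node J r) / (2 - node J r)) := by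
  unfold F
  rw [Finset.mul_sum]
  refine Finset.sum_congr rfl fun r hr => ?_
  have h1 := node_le_one hJ (show r ≤ 2 * J by rw [Finset.mem_range] at hr; omega)
  have h2 : 0 < 2 - node J r := by linarith
  have h3 := (Real.Gamma_pos_of_pos h2).ne'
  rw [show 3 - node J r = 2 - node J r + 1 by ring, Real.Gamma_add_one h2.ne',
    show τ ^ (2 - node J r) = τ ^ 2 * τ ^ (-node J r) by
      rw [sub_eq_add_neg, Real.rpow_add hτ, Real.rpow_two], orderWeight]
  field_simp
  ring

theorem sum_orderWeight_eq_zero (hJ : 1 ≤ J) (hτ : 0 < τ) (hF : F J w τ σ = 0) :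
    ∑ r ∈ Finset.range (2 * J + 1),
      orderWeight J w τ r * (σ ^ (1 - node J r) * (2 * σ - 2 + node J r) / (2 - node J r)) = 0 := by
  rw [F_eq_sum hJ hτ] at hF
  exact (mul_eq_zero.1 hF).resolve_left (by positivity)

/-- For σ < 1/2 every 2σ - 2 + α_r is negative, for σ > 1 every one is positive; the node of
positive weight makes the sum nonzero. -/
theorem half_le_and_le_one (hJ : 1 ≤ J) (hw : ∀ α ∈ Set.Icc (0 : ℝ) 1, 0 ≤ w α) (hτ : 0 < τ)
    (hw' : ∃ r : ℕ, r < 2 * J ∧ 0 < w (node J r)) (hσ : 0 < σ) (hF : F J w τ σ = 0) :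
    1 / 2 ≤ σ ∧ σ ≤ 1 := by
  have h := sum_orderWeight_eq_zero hJ hτ hF
  obtain ⟨r₀, hr₀, hwr⟩ := hw'
  have hp := orderWeight_pos hJ hτ hr₀.le hwr
  have hn₀ := node_lt_one hJ hr₀
  have hmem : r₀ ∈ Finset.range (2 * J + 1) := by rw [Finset.mem_range]; omega
  constructor
  · by_contra! hc
    refine h.not_lt (Finset.sum_neg' (fun r hr => ?_) ⟨r₀, hmem, ?_⟩)
    · rw [Finset.mem_range] at hr
      have h1 := node_le_one hJ (show r ≤ 2 * J by omega)
      refine mul_nonpos_of_nonneg_of_nonpos (orderWeight_nonneg hJ hw hτ (by omega))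
        (div_nonpos_of_nonpos_of_nonneg
          (mul_nonpos_of_nonneg_of_nonpos (Real.rpow_nonneg hσ.le _) (by linarith)) (by linarith))
    · exact mul_neg_of_pos_of_neg hp (div_neg_of_neg_of_pos
        (mul_neg_of_pos_of_neg (Real.rpow_pos_of_pos hσ _) (by linarith)) (by linarith))
  · by_contra! hc
    refine h.not_gt (Finset.sum_pos' (fun r hr => ?_) ⟨r₀, hmem, ?_⟩)
    · rw [Finset.mem_range] at hr
      have h1 := node_le_one hJ (show r ≤ 2 * J by omega)
      have h0 := node_nonneg J r
      exact mul_nonneg (orderWeight_nonneg hJ hw hτ (by omega))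
        (div_nonneg (mul_nonneg (Real.rpow_nonneg hσ.le _) (by linarith)) (by linarith))
    · have h0 := node_nonneg J r₀
      exact mul_pos hp (div_pos (mul_pos (Real.rpow_pos_of_pos hσ _) (by linarith)) (by linarith))

theorem cHat_succ_le (hJ : 1 ≤ J) (hw : ∀ α ∈ Set.Icc (0 : ℝ) 1, 0 ≤ w α) (hτ : 0 < τ)
    (hσ : 0 < σ) {n k : ℕ} (hk : 1 ≤ k) (hkn : k + 1 < n) :
    cHat J w τ σ n (k + 1) ≤ cHat J w τ σ n k := by
  rw [cHat_eq_sum, cHat_eq_sum]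
  refine Finset.sum_le_sum fun r hr => ?_
  rw [Finset.mem_range] at hr
  exact mul_le_mul_of_nonneg_left
    (cCoeff_succ_le hσ (node_nonneg J r) (node_le_one hJ (by omega)) hk hkn)
    (orderWeight_nonneg hJ hw hτ (by omega))

theorem sq_mul_cHat_one_le (hJ : 1 ≤ J) (hw : ∀ α ∈ Set.Icc (0 : ℝ) 1, 0 ≤ w α) (hτ : 0 < τ)
    (hσ : 1 / 2 ≤ σ) (hF : F J w τ σ = 0) {n : ℕ} (hn : 2 ≤ n) :
    σ ^ 2 * cHat J w τ σ n 1 ≤ (2 * σ - 1) * cHat J w τ σ n 0 := by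
  have h := sum_orderWeight_eq_zero hJ hτ hF
  rw [cHat_eq_sum, cHat_eq_sum, Finset.mul_sum, Finset.mul_sum, ← sub_nonneg,
    ← Finset.sum_sub_distrib, ← h]
  refine Finset.sum_le_sum fun r hr => ?_
  rw [Finset.mem_range] at hr
  have := mul_le_mul_of_nonneg_left
    (two_mul_sub_mul_cCoeff hσ (node_nonneg J r) (node_le_one hJ (by omega)) hn)
    (orderWeight_nonneg hJ hw hτ (show r ≤ 2 * J by omega))
  linarith

theorem half_weightSum_le_cHat_last (hJ : 1 ≤ J) (hw : ∀ α ∈ Set.Icc (0 : ℝ) 1, 0 ≤ w α)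
    (hτ : 0 < τ) (hσ : 1 / 2 ≤ σ) (hσ1 : σ ≤ 1) {T : ℝ} {n : ℕ} (hn : 1 ≤ n)
    (hnT : n * τ ≤ T) : weightSum J w T / 2 ≤ cHat J w τ σ n (n - 1) := by
  rw [cHat_eq_sum, weightSum, Finset.sum_div]
  refine Finset.sum_le_sum fun r hr => ?_
  rw [Finset.mem_range] at hr
  have h0 := node_nonneg J r
  have h1 := node_le_one hJ (show r ≤ 2 * J by omega)
  have hn' : (1 : ℝ) ≤ n := by exact_mod_cast hn
  have hx : 0 < (n : ℝ) - 1 + σ := by linarith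
  refine le_trans ?_ (mul_le_mul_of_nonneg_left (le_cCoeff_last hσ h0 h1 hn)
    (orderWeight_nonneg hJ hw hτ (by omega)))
  rcases h1.eq_or_lt with h1 | h1
  -- At α = 1 both sides vanish: Γ(0) = 0 by default on the left, the factor 1 - α on the right.
  · simp [h1]
  · have hxT : (τ * ((n : ℝ) - 1 + σ)) ≤ T := by nlinarith
    have hT : 0 < T := (mul_pos hτ hx).trans_le hxT
    have hs : 0 < 1 - node J r := by linarith
    have hG := Real.Gamma_pos_of_pos hs
    have hl := lam_nonneg hJ (show r ≤ 2 * J by omega) hw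
    have hpow : T ^ (-node J r) ≤ τ ^ (-node J r) * ((n : ℝ) - 1 + σ) ^ (-node J r) := by
      rw [← Real.mul_rpow hτ.le hx.le]
      exact Real.rpow_le_rpow_of_nonpos (mul_pos hτ hx) hxT (by linarith)
    rw [orderWeight, show 2 - node J r = 1 - node J r + 1 by ring, Real.Gamma_add_one hs.ne']
    calc lam J w r / (T ^ node J r * Real.Gamma (1 - node J r)) / 2
        = lam J w r / (2 * Real.Gamma (1 - node J r)) * T ^ (-node J r) := by
          rw [Real.rpow_neg hT.le]; field_simp
      _ ≤ lam J w r / (2 * Real.Gamma (1 - node J r))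
          * (τ ^ (-node J r) * ((n : ℝ) - 1 + σ) ^ (-node J r)) := by gcongr
      _ = _ := by field_simp

theorem weightSum_pos (hJ : 1 ≤ J) (hw : ∀ α ∈ Set.Icc (0 : ℝ) 1, 0 ≤ w α)
    (hw' : ∃ r : ℕ, r < 2 * J ∧ 0 < w (node J r)) {T : ℝ} (hT : 0 < T) : 0 < weightSum J w T := by
  obtain ⟨r₀, hr₀, hwr⟩ := hw'
  refine Finset.sum_pos' (fun r hr => ?_) ⟨r₀, by rw [Finset.mem_range]; omega, ?_⟩
  · rw [Finset.mem_range] at hr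
    have h1 := node_le_one hJ (show r ≤ 2 * J by omega)
    have hl := lam_nonneg hJ (show r ≤ 2 * J by omega) hw
    have hG := Real.Gamma_nonneg_of_nonneg (show 0 ≤ 1 - node J r by linarith)
    positivity
  · have h1 := node_lt_one hJ hr₀
    have hG := Real.Gamma_pos_of_pos (show 0 < 1 - node J r₀ by linarith)
    have hl := lam_pos hJ hwr
    positivity

end

/-! ### The energy method -/

theorem sum_range_mul_sub_succ (c e : ℕ → ℝ) (n : ℕ) :
    ∑ k ∈ Finset.range (n + 1), c k * (e (k + 1) - e k)
      = -(c 0 * e 0) + ∑ k ∈ Finset.range n, (c k - c (k + 1)) * e (k + 1) + c n * e (n + 1) := by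
  induction n with
  | zero => simp; ring
  | succ n ih => rw [Finset.sum_range_succ, ih, Finset.sum_range_succ]; ring

/-- The discrete convexity inequality behind the energy estimate. Here `y k` stands for
`u^{n-k}`. -/
theorem sum_mul_sub_sq_le {σ : ℝ} (hσ : 1 / 2 ≤ σ) {n : ℕ} (hn : 1 ≤ n) (c : ℕ → ℝ)
    (hanti : ∀ k, 1 ≤ k → k + 1 < n → c (k + 1) ≤ c k) (hlast : 0 ≤ c (n - 1))
    (hone : 2 ≤ n → σ ^ 2 * c 1 ≤ (2 * σ - 1) * c 0) (y : ℕ → ℝ) :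
    1 / 2 * ∑ k ∈ Finset.range n, c k * (y k ^ 2 - y (k + 1) ^ 2)
      ≤ (∑ k ∈ Finset.range n, c k * (y k - y (k + 1))) * (σ * y 0 + (1 - σ) * y 1) := by
  obtain ⟨m, rfl⟩ := Nat.exists_eq_add_of_le' hn
  set v := σ * y 0 + (1 - σ) * y 1 with hv
  -- (a-b)v - (a²-b²)/2 = ½((b-v)² - (a-v)²); Abel summation then moves the differences onto c.
  have hid : (∑ k ∈ Finset.range (m + 1), c k * (y k - y (k + 1))) * v
      - 1 / 2 * ∑ k ∈ Finset.range (m + 1), c k * (y k ^ 2 - y (k + 1) ^ 2)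
      = 1 / 2 * ∑ k ∈ Finset.range (m + 1), c k * ((y (k + 1) - v) ^ 2 - (y k - v) ^ 2) := by
    rw [Finset.sum_mul, Finset.mul_sum, Finset.mul_sum, ← Finset.sum_sub_distrib]
    exact Finset.sum_congr rfl fun k _ => by ring
  rw [← sub_nonneg, hid]
  refine mul_nonneg (by norm_num) ?_
  rw [sum_range_mul_sub_succ c (fun k => (y k - v) ^ 2)]
  rw [Nat.add_sub_cancel] at hlast
  rcases Nat.eq_zero_or_pos m with rfl | hm
  · have : -(c 0 * (y 0 - v) ^ 2) + c 0 * (y 1 - v) ^ 2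
        = c 0 * (2 * σ - 1) * (y 0 - y 1) ^ 2 := by rw [hv]; ring
    simp only [Finset.range_zero, Finset.sum_empty, add_zero, zero_add]
    rw [this]
    exact mul_nonneg (mul_nonneg hlast (by linarith)) (sq_nonneg _)
  · obtain ⟨p, rfl⟩ := Nat.exists_eq_add_of_le' hm
    rw [Finset.sum_range_succ']
    have h1 : 0 ≤ ∑ k ∈ Finset.range p, (c (k + 1) - c (k + 1 + 1)) * (y (k + 1 + 1) - v) ^ 2 := by
      refine Finset.sum_nonneg fun k hk => ?_
      rw [Finset.mem_range] at hk
      exact mul_nonneg (sub_nonneg.2 (hanti (k + 1) (by omega) (by omega))) (sq_nonneg _)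
    -- y_0 - v = (1-σ)(y_0 - y_1) and y_1 - v = -σ(y_0 - y_1), whence the exact form of `hone`.
    have h2 : -(c 0 * (y 0 - v) ^ 2) + (c 0 - c 1) * (y 1 - v) ^ 2
        = ((2 * σ - 1) * c 0 - σ ^ 2 * c 1) * (y 0 - y 1) ^ 2 := by rw [hv]; ring
    have h3 : 0 ≤ ((2 * σ - 1) * c 0 - σ ^ 2 * c 1) * (y 0 - y 1) ^ 2 :=
      mul_nonneg (sub_nonneg.2 (hone (by omega))) (sq_nonneg _)
    have h4 := mul_nonneg hlast (sq_nonneg (y (p + 1 + 1) - v))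
    simp only [zero_add]
    linarith

/-- The discrete Grönwall-type argument for decreasing kernels. -/
theorem le_of_sum_mul_sub_le {n : ℕ} (hn : 1 ≤ n) (c : ℕ → ℝ)
    (hanti : ∀ k, k + 1 < n → c (k + 1) ≤ c k) (hlast : 0 < c (n - 1)) {E : ℕ → ℝ} {D : ℝ}
    (hE : ∀ l, 1 ≤ l → l < n → E l ≤ E 0 + D)
    (h : ∑ k ∈ Finset.range n, c k * (E (n - k) - E (n - k - 1)) ≤ c (n - 1) * D) :
    E n ≤ E 0 + D := by
  obtain ⟨m, rfl⟩ := Nat.exists_eq_add_of_le' hn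
  rw [Nat.add_sub_cancel] at hlast h
  -- Subtracting E 0 + D makes the final boundary term -c_m D, which cancels the right side of `h`.
  have hid := sum_range_mul_sub_succ c (fun k => E (m + 1 - k) - (E 0 + D)) m
  have h1 : ∑ k ∈ Finset.range (m + 1), c k * (E (m + 1 - k) - E (m + 1 - k - 1))
      = -∑ k ∈ Finset.range (m + 1), c k * ((E (m + 1 - (k + 1)) - (E 0 + D))
        - (E (m + 1 - k) - (E 0 + D))) := by
    rw [← Finset.sum_neg_distrib]
    refine Finset.sum_congr rfl fun k _ => ?_
    rw [Nat.sub_sub]; ring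
  rw [h1, hid] at h
  have h2 : ∑ k ∈ Finset.range m, (c k - c (k + 1)) * (E (m + 1 - (k + 1)) - (E 0 + D)) ≤ 0 := by
    refine Finset.sum_nonpos fun k hk => ?_
    rw [Finset.mem_range] at hk
    exact mul_nonpos_of_nonneg_of_nonpos (sub_nonneg.2 (hanti k (by omega)))
      (sub_nonpos.2 (hE _ (by omega) (by omega)))
  simp only [Nat.sub_zero, Nat.sub_self] at h
  have hc0 : ∀ j, j ≤ m → 0 < c (m - j) := by
    intro j hj
    induction j with
    | zero => exact hlast
    | succ j ih =>
      have := hanti (m - (j + 1)) (by omega)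
      rw [show m - (j + 1) + 1 = m - j by omega] at this
      exact (ih (by omega)).trans_le this
  have h0 := hc0 m le_rfl
  rw [Nat.sub_self] at h0
  have : c 0 * (E (m + 1) - (E 0 + D)) ≤ 0 := by linarith
  linarith [nonpos_of_mul_nonpos_right this h0]


/-! ### The energy estimate for the scheme -/

theorem sum_sub_sq_le_of_coercive {ι : Type*} (s : Finset ι) {n : ℕ} (hn : 1 ≤ n) {σ : ℝ}
    (hσ : 1 / 2 ≤ σ) (c : ℕ → ℝ) (hanti : ∀ k, 1 ≤ k → k + 1 < n → c (k + 1) ≤ c k)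
    (hlast : 0 ≤ c (n - 1)) (hone : 2 ≤ n → σ ^ 2 * c 1 ≤ (2 * σ - 1) * c 0)
    (u : ℕ → ι → ℝ) (g b : ι → ℝ) {A : ℝ} (hA : 0 < A)
    (heq : ∀ x ∈ s, ∑ k ∈ Finset.range n, c k * (u (n - k) x - u (n - k - 1) x) = -b x + g x)
    (hb : A * ∑ x ∈ s, (σ * u n x + (1 - σ) * u (n - 1) x) ^ 2
      ≤ ∑ x ∈ s, b x * (σ * u n x + (1 - σ) * u (n - 1) x)) :
    ∑ k ∈ Finset.range n, c k * (∑ x ∈ s, u (n - k) x ^ 2 - ∑ x ∈ s, u (n - k - 1) x ^ 2)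
      ≤ 1 / (2 * A) * ∑ x ∈ s, g x ^ 2 := by
  have h1 : ∀ x ∈ s, 1 / 2 * ∑ k ∈ Finset.range n, c k * (u (n - k) x ^ 2 - u (n - k - 1) x ^ 2)
      ≤ (-b x + g x) * (σ * u n x + (1 - σ) * u (n - 1) x) := fun x hx => by
    rw [← heq x hx]
    exact sum_mul_sub_sq_le hσ hn c hanti hlast hone (fun k => u (n - k) x)
  have h2 : ∀ x ∈ s, g x * (σ * u n x + (1 - σ) * u (n - 1) x)
      ≤ A * (σ * u n x + (1 - σ) * u (n - 1) x) ^ 2 + 1 / (4 * A) * g x ^ 2 := fun x _ => by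
    have e := mul_nonneg (show 0 ≤ 1 / (4 * A) by positivity)
      (sq_nonneg (g x - 2 * A * (σ * u n x + (1 - σ) * u (n - 1) x)))
    rw [← sub_nonneg]
    refine e.trans_eq ?_
    field_simp
    ring
  have h3 := Finset.sum_le_sum fun x hx => (h1 x hx).trans
    (show (-b x + g x) * (σ * u n x + (1 - σ) * u (n - 1) x)
      ≤ -(b x * (σ * u n x + (1 - σ) * u (n - 1) x))
        + (A * (σ * u n x + (1 - σ) * u (n - 1) x) ^ 2 + 1 / (4 * A) * g x ^ 2) by
      linarith [h2 x hx])
  rw [Finset.sum_add_distrib, Finset.sum_neg_distrib, Finset.sum_add_distrib, ← Finset.mul_sum,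
    ← Finset.mul_sum, ← Finset.mul_sum, Finset.sum_comm] at h3
  simp_rw [← Finset.mul_sum, Finset.sum_sub_distrib] at h3
  have e : 1 / (2 * A) * ∑ x ∈ s, g x ^ 2 = 2 * (1 / (4 * A) * ∑ x ∈ s, g x ^ 2) := by
    field_simp; ring
  rw [e]
  linarith

/-- The mesh size drops out here, which makes the stability unconditional. -/
theorem mul_rpow_neg_mul_cStar {β L : ℝ} (hL : 0 < L) {M : ℕ} (hM : 1 ≤ M) :
    (L / M) ^ (-β) * (2 * (M : ℝ)) ^ (-β) = ((2 * L) ^ β)⁻¹ := by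
  have : (0 : ℝ) < M := by exact_mod_cast hM
  rw [← Real.mul_rpow (by positivity) (by positivity), ← Real.rpow_neg (by positivity)]
  congr 1
  field_simp

/-- The interior nodes of the grid. -/
def interiorNodes (M₁ M₂ : ℕ) : Finset (ℤ × ℤ) :=
  Finset.Icc (1 : ℤ) ((M₁ : ℤ) - 1) ×ˢ Finset.Icc (1 : ℤ) ((M₂ : ℤ) - 1)

theorem normSq_eq_sum_interior (h₁ h₂ : ℝ) (M₁ M₂ : ℕ) (v : ℤ → ℤ → ℝ) :
    normSq h₁ h₂ M₁ M₂ v = h₁ * h₂ * ∑ x ∈ interiorNodes M₁ M₂, v x.1 x.2 ^ 2 := by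
  rw [interiorNodes, Finset.sum_product]; rfl

theorem one_div_add_le {a b : ℝ} (ha : 0 < a) (hb : 0 < b) :
    1 / (2 * (a + b)) ≤ 1 / 8 * (1 / a + 1 / b) := by
  have e : 1 / 8 * (1 / a + 1 / b) = (a + b) / (8 * a * b) := by field_simp; ring
  rw [e, div_le_div_iff₀ (by positivity) (by positivity)]
  nlinarith [sq_nonneg (a - b)]

theorem coercive_interior {β γ : ℝ} (hβ : 1 < β) (hβ' : β < 2) (hγ : 1 < γ) (hγ' : γ < 2)
    {L₁ L₂ K₁ K₂ : ℝ} (hL₁ : 0 < L₁) (hL₂ : 0 < L₂) (hK₁ : 0 < K₁) (hK₂ : 0 < K₂) {M₁ M₂ : ℕ}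
    (hM₁ : 1 ≤ M₁) (hM₂ : 1 ≤ M₂) {v : ℤ → ℤ → ℝ}
    (h1 : ∀ j ∈ Finset.Icc (1 : ℤ) ((M₂ : ℤ) - 1), v 0 j = 0 ∧ v M₁ j = 0)
    (h2 : ∀ i ∈ Finset.Icc (1 : ℤ) ((M₁ : ℤ) - 1), v i 0 = 0 ∧ v i M₂ = 0) :
    (K₁ * cStar β / (2 * L₁) ^ β + K₂ * cStar γ / (2 * L₂) ^ γ)
        * ∑ x ∈ interiorNodes M₁ M₂, v x.1 x.2 ^ 2
      ≤ ∑ x ∈ interiorNodes M₁ M₂, (K₁ * (L₁ / M₁) ^ (-β) * centredDiff β M₁ (fun p => v p x.2) x.1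
          + K₂ * (L₂ / M₂) ^ (-γ) * centredDiff γ M₂ (fun q => v x.1 q) x.2) * v x.1 x.2 := by
  have hc1 : 0 ≤ K₁ * (L₁ / M₁) ^ (-β) := by positivity
  have hc2 : 0 ≤ K₂ * (L₂ / M₂) ^ (-γ) := by positivity
  have e1 := Finset.sum_le_sum fun j hj => mul_le_mul_of_nonneg_left
    (cStar_mul_sum_sq_le hβ hβ' hM₁ (v := fun p => v p j) (h1 j hj).1 (h1 j hj).2) hc1
  have e2 := Finset.sum_le_sum fun i hi => mul_le_mul_of_nonneg_left
    (cStar_mul_sum_sq_le hγ hγ' hM₂ (v := fun q => v i q) (h2 i hi).1 (h2 i hi).2) hc2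
  have a1 : K₁ * cStar β / (2 * L₁) ^ β
      = K₁ * (L₁ / M₁) ^ (-β) * (cStar β * (2 * (M₁ : ℝ)) ^ (-β)) := by
    rw [div_eq_mul_inv, ← mul_rpow_neg_mul_cStar hL₁ hM₁]; ring
  have a2 : K₂ * cStar γ / (2 * L₂) ^ γ
      = K₂ * (L₂ / M₂) ^ (-γ) * (cStar γ * (2 * (M₂ : ℝ)) ^ (-γ)) := by
    rw [div_eq_mul_inv, ← mul_rpow_neg_mul_cStar hL₂ hM₂]; ring
  rw [a1, a2, add_mul]
  simp_rw [add_mul, Finset.sum_add_distrib]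
  refine add_le_add ?_ ?_
  · rw [interiorNodes, Finset.sum_product_right, Finset.sum_product_right]
    simp only [Finset.mul_sum] at e1 ⊢
    simpa only [mul_assoc] using e1
  · rw [interiorNodes, Finset.sum_product, Finset.sum_product]
    simp only [Finset.mul_sum] at e2 ⊢
    simpa only [mul_assoc] using e2

end TDRFDE
end

theorem mainTheorem5
    (L₁ L₂ T K₁ K₂ β γ : ℝ)
    (hL₁ : 0 < L₁) (hL₂ : 0 < L₂) (hT : 0 < T) (hK₁ : 0 < K₁) (hK₂ : 0 < K₂)
    (hβ : 1 < β) (hβ' : β < 2) (hγ : 1 < γ) (hγ' : γ < 2)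
    (J M₁ M₂ N : ℕ) (hJ : 1 ≤ J) (hM₁ : 1 ≤ M₁) (hM₂ : 1 ≤ M₂) (hN : 1 ≤ N)
    (w : ℝ → ℝ) (hw : ∀ α ∈ Set.Icc (0 : ℝ) 1, 0 ≤ w α)
    (hw' : ∃ r : ℕ, r < 2 * J ∧ 0 < w (TDRFDE.node J r))
    (f : ℝ → ℝ → ℝ → ℝ) (φ : ℝ → ℝ → ℝ)
    (σ : ℝ) (hσ : 0 < σ) (hF : TDRFDE.F J w (T / N) σ = 0)
    (u : ℕ → ℤ → ℤ → ℝ)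
    (hu : TDRFDE.IsSchemeSolution L₁ L₂ T K₁ K₂ β γ w f φ J M₁ M₂ N σ u)
    (n : ℕ) (hn : 1 ≤ n) (hnN : n ≤ N) :
    TDRFDE.normSq (L₁ / M₁) (L₂ / M₂) M₁ M₂ (u n) ≤
      TDRFDE.normSq (L₁ / M₁) (L₂ / M₂) M₁ M₂ (u 0)
        + 1 / 4 * ((2 * L₁) ^ β / (K₁ * TDRFDE.cStar β) + (2 * L₂) ^ γ / (K₂ * TDRFDE.cStar γ))
          / TDRFDE.weightSum J w T
          * (Finset.Icc 1 n).sup' (Finset.nonempty_Icc.mpr hn) (fun l =>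
              TDRFDE.normSq (L₁ / M₁) (L₂ / M₂) M₁ M₂
                (TDRFDE.sourceGrid f (L₁ / M₁) (L₂ / M₂) (T / N) σ l)) := by
  open TDRFDE in
  set Fmax := (Finset.Icc 1 n).sup' (Finset.nonempty_Icc.mpr hn) (fun l =>
    normSq (L₁ / M₁) (L₂ / M₂) M₁ M₂ (sourceGrid f (L₁ / M₁) (L₂ / M₂) (T / N) σ l)) with hFmax
  have hN0 : (0 : ℝ) < N := by exact_mod_cast hN
  have hτ : 0 < T / N := by positivity
  obtain ⟨hσ2, hσ1⟩ := half_le_and_le_one hJ hw hτ hw' hσ hF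
  have hW := weightSum_pos hJ hw hw' hT
  have hcβ := cStar_pos hβ hβ'
  have hcγ := cStar_pos hγ hγ'
  set A₁ := K₁ * cStar β / (2 * L₁) ^ β with hA₁
  set A₂ := K₂ * cStar γ / (2 * L₂) ^ γ with hA₂
  have hA₁0 : 0 < A₁ := by positivity
  have hA₂0 : 0 < A₂ := by positivity
  rw [show (2 * L₁) ^ β / (K₁ * cStar β) = 1 / A₁ by rw [hA₁, one_div_div],
    show (2 * L₂) ^ γ / (K₂ * cStar γ) = 1 / A₂ by rw [hA₂, one_div_div]]
  have hh : 0 ≤ L₁ / M₁ * (L₂ / M₂) := by positivity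
  have main : ∀ l, l ≤ n → 1 ≤ l → normSq (L₁ / M₁) (L₂ / M₂) M₁ M₂ (u l)
      ≤ normSq (L₁ / M₁) (L₂ / M₂) M₁ M₂ (u 0)
        + 1 / 4 * (1 / A₁ + 1 / A₂) / weightSum J w T * Fmax := by
    intro l
    induction l using Nat.strong_induction_on with
    | _ l ih =>
    intro hln hl
    have hlast := half_weightSum_le_cHat_last hJ hw hτ hσ2 hσ1 (T := T) hl (by
      have : (l : ℝ) ≤ N := by exact_mod_cast hln.trans hnN
      rw [mul_div_assoc', div_le_iff₀ hN0]
      nlinarith)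
    have hlast0 : 0 < cHat J w (T / N) σ l (l - 1) := (half_pos hW).trans_le hlast
    have hanti : ∀ k, 1 ≤ k → k + 1 < l → cHat J w (T / N) σ l (k + 1) ≤ cHat J w (T / N) σ l k :=
      fun k hk hkl => cHat_succ_le hJ hw hτ hσ hk hkl
    have hone : 2 ≤ l → σ ^ 2 * cHat J w (T / N) σ l 1 ≤ (2 * σ - 1) * cHat J w (T / N) σ l 0 :=
      fun h2 => sq_mul_cHat_one_le hJ hw hτ hσ2 hF h2
    have hanti' : ∀ k, k + 1 < l → cHat J w (T / N) σ l (k + 1) ≤ cHat J w (T / N) σ l k := by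
      -- For k = 0, σ² ĉ_1 ≤ (2σ-1) ĉ_0 ≤ σ² ĉ_0, as (σ-1)² ≥ 0; ĉ_0 > 0 follows from ĉ_1 ≥ ĉ_{l-1}
      -- > 0.
      intro k hkl
      rcases Nat.eq_zero_or_pos k with rfl | hk
      · have h1 : ∀ j, j ≤ l - 2 → 0 < cHat J w (T / N) σ l (l - 1 - j) := by
          intro j hj
          induction j with
          | zero => exact hlast0
          | succ j ihj =>
            have := hanti (l - 1 - (j + 1)) (by omega) (by omega)
            rw [show l - 1 - (j + 1) + 1 = l - 1 - j by omega] at this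
            exact (ihj (by omega)).trans_le this
        have h1 := h1 (l - 2) le_rfl
        rw [show l - 1 - (l - 2) = 1 by omega] at h1
        have h2 := hone (by omega)
        have h3 : 0 < (2 * σ - 1) * cHat J w (T / N) σ l 0 :=
          (mul_pos (by positivity) h1).trans_le h2
        have h4 : 0 < cHat J w (T / N) σ l 0 := pos_of_mul_pos_right h3 (by linarith)
        have h5 : (2 * σ - 1) * cHat J w (T / N) σ l 0 ≤ σ ^ 2 * cHat J w (T / N) σ l 0 :=
          mul_le_mul_of_nonneg_right (by nlinarith [sq_nonneg (σ - 1)]) h4.le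
        exact le_of_mul_le_mul_left (h2.trans h5) (by positivity)
      · exact hanti k hk hkl
    have hbd : ∀ i j : ℤ, 0 ≤ i → i ≤ (M₁ : ℤ) → 0 ≤ j → j ≤ (M₂ : ℤ) →
        (i = 0 ∨ i = (M₁ : ℤ) ∨ j = 0 ∨ j = (M₂ : ℤ)) →
        σ * u l i j + (1 - σ) * u (l - 1) i j = 0 := by
      intro i j hi hi' hj hj' h
      rw [hu.boundary l (by omega) i j hi hi' hj hj' h,
        hu.boundary (l - 1) (by omega) i j hi hi' hj hj' h]
      ring
    have hco := coercive_interior hβ hβ' hγ hγ' hL₁ hL₂ hK₁ hK₂ hM₁ hM₂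
      (v := fun i j => σ * u l i j + (1 - σ) * u (l - 1) i j)
      (fun j hj => by
        rw [Finset.mem_Icc] at hj
        exact ⟨hbd _ _ (by omega) (by omega) (by omega) (by omega) (by simp),
          hbd _ _ (by omega) (by omega) (by omega) (by omega) (by simp)⟩)
      (fun i hi => by
        rw [Finset.mem_Icc] at hi
        exact ⟨hbd _ _ (by omega) (by omega) (by omega) (by omega) (by simp),
          hbd _ _ (by omega) (by omega) (by omega) (by omega) (by simp)⟩)
    have hen := sum_sub_sq_le_of_coercive (interiorNodes M₁ M₂) hl hσ2 (cHat J w (T / N) σ l) hanti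
      hlast0.le hone (fun m x => u m x.1 x.2)
      (fun x => sourceGrid f (L₁ / M₁) (L₂ / M₂) (T / N) σ l x.1 x.2) _
      (add_pos hA₁0 hA₂0) (fun x hx => by
        rw [interiorNodes, Finset.mem_product, Finset.mem_Icc, Finset.mem_Icc] at hx
        rw [hu.eqn l hl (by omega) x.1 x.2 hx.1.1 hx.1.2 hx.2.1 hx.2.2]
        ring) hco
    refine le_of_sum_mul_sub_le hl (cHat J w (T / N) σ l) hanti' hlast0
      (E := fun m => normSq (L₁ / M₁) (L₂ / M₂) M₁ M₂ (u m))
      (fun m hm hml => ih m hml (by omega) hm) ?_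
    have hFl : normSq (L₁ / M₁) (L₂ / M₂) M₁ M₂ (sourceGrid f (L₁ / M₁) (L₂ / M₂) (T / N) σ l)
        ≤ Fmax := Finset.le_sup' (fun l => normSq (L₁ / M₁) (L₂ / M₂) M₁ M₂
          (sourceGrid f (L₁ / M₁) (L₂ / M₂) (T / N) σ l)) (Finset.mem_Icc.2 ⟨hl, hln⟩)
    have hF0 : 0 ≤ normSq (L₁ / M₁) (L₂ / M₂) M₁ M₂
        (sourceGrid f (L₁ / M₁) (L₂ / M₂) (T / N) σ l) := by
      rw [normSq_eq_sum_interior]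
      exact mul_nonneg hh (Finset.sum_nonneg fun _ _ => sq_nonneg _)
    calc ∑ k ∈ Finset.range l, cHat J w (T / N) σ l k *
          (normSq (L₁ / M₁) (L₂ / M₂) M₁ M₂ (u (l - k))
            - normSq (L₁ / M₁) (L₂ / M₂) M₁ M₂ (u (l - k - 1)))
        = L₁ / M₁ * (L₂ / M₂) * ∑ k ∈ Finset.range l, cHat J w (T / N) σ l k *
          (∑ x ∈ interiorNodes M₁ M₂, u (l - k) x.1 x.2 ^ 2
            - ∑ x ∈ interiorNodes M₁ M₂, u (l - k - 1) x.1 x.2 ^ 2) := by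
          simp_rw [normSq_eq_sum_interior]
          rw [Finset.mul_sum]
          exact Finset.sum_congr rfl fun k _ => by ring
      _ ≤ L₁ / M₁ * (L₂ / M₂) * (1 / (2 * (A₁ + A₂)) * ∑ x ∈ interiorNodes M₁ M₂,
          sourceGrid f (L₁ / M₁) (L₂ / M₂) (T / N) σ l x.1 x.2 ^ 2) :=
          mul_le_mul_of_nonneg_left hen hh
      _ = 1 / (2 * (A₁ + A₂)) * normSq (L₁ / M₁) (L₂ / M₂) M₁ M₂
          (sourceGrid f (L₁ / M₁) (L₂ / M₂) (T / N) σ l) := by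
          rw [normSq_eq_sum_interior]; ring
      _ ≤ 1 / 8 * (1 / A₁ + 1 / A₂) * Fmax :=
          mul_le_mul (one_div_add_le hA₁0 hA₂0) hFl hF0 (by positivity)
      -- The 1/8 splits into the 1/4 of the claim and the 1/2 from the bound on the last
      -- coefficient.
      _ = weightSum J w T / 2 * (1 / 4 * (1 / A₁ + 1 / A₂) / weightSum J w T * Fmax) := by
          field_simp; ring
      _ ≤ _ := mul_le_mul_of_nonneg_right hlast
          (mul_nonneg (by positivity) (hF0.trans hFl))
  exact main n le_rfl hn
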